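/- Let $d\in\mathbb N$, let $Q$ be a real symmetric positive definite $d\times d$ matrix and let $B$ be a nonzero real $d\times d$ matrix all of whose (complex) eigenvalues have negative real part. Put $$Q_t=\int_0^t e^{sB}Qe^{sB^*}\,ds\quad(0<t\le\infty),\qquad d\gamma_t(x)=(2\pi)^{-d/2}(\det Q_t)^{-1/2}e^{-\frac12\langle Q_t^{-1}x,x\rangle}\,dx .$$ The Ornstein–Uhlenbeck semigroup $\mathcal H_tf(x)=\int f(e^{tB}x-y)\,d\gamma_t(y)$, $t>0$, with covariance $Q$ and drift $B$ has the kernel $$h_t(x,y)=\det(Q_\infty Q_t^{-1})^{1/2}\exp\Big(-\tfrac12\big[\langle Q_t^{-1}(e^{tB}x-y),\,e^{tB}x-y\rangle-\langle Q_\infty^{-1}y,y\rangle\big]\Big)$$ with respect to its invariant measure $\gamma_\infty$. Let $$L=\{(x,y)\in\mathbb R^d\times\mathbb R^d:\ |x-y|\le\min(1,|x+y|^{-1})\},$$ where $|\cdot|$ is the Euclidean norm and $0^{-1}=\infty$, and for real- or complex-valued $f\in L^1(\gamma_\infty)$ let $$\mathcal H^{\mathrm{loc}}_*f(x)=\sup_{t>0}\Big|\int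 h_t(x,y)\,\mathbf 1_L(x,y)\,f(y)\,d\gamma_\infty(y)\Big| .$$ Then for every $f\in L^1(\gamma_\infty)$ these integrals converge absolutely for all $x\in\mathbb R^d$ and $t>0$, and $\mathcal H^{\mathrm{loc}}_*$ is of weak type $(1,1)$ with respect to $\gamma_\infty$: for every $f\in L^1(\gamma_\infty)$ the function $\mathcal H^{\mathrm{loc}}_*f$ is $\gamma_\infty$-measurable, and there is a finite constant $C$, independent of $f$ and $\alpha$, such that $$\gamma_\infty\big(\{x\in\mathbb R^d:\ \mathcal H^{\mathrm{loc}}_*f(x)>\alpha\}\big)\le\frac{C\,\|f\|_{L^1(\gamma_\infty)}}{\alpha}\qquad\text{for all } f\in L^1(\gamma_\infty),\ \alpha>0 .$$ -/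

import Mathlib

open MeasureTheory Set
open scoped ENNReal NNReal Matrix

noncomputable section

namespace OrnsteinUhlenbeck

/-- The space `ℝ^d` with its Euclidean norm and Lebesgue measure. -/
abbrev Space (d : ℕ) : Type := EuclideanSpace ℝ (Fin d)

variable {d : ℕ}

/-- `B` is stable: every complex eigenvalue of the real matrix `B` has negative real part. -/
def IsStable (B : Matrix (Fin d) (Fin d) ℝ) : Prop :=
  ∀ μ ∈ spectrum ℂ (B.map (algebraMap ℝ ℂ)), μ.re < 0

/-- The integral `∫_S e^{sB} Q e^{sB*} ds` of a matrix-valued function, taken entry by entry. -/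
def covarianceOn (Q B : Matrix (Fin d) (Fin d) ℝ) (S : Set ℝ) : Matrix (Fin d) (Fin d) ℝ :=
  Matrix.of fun i j =>
    ∫ s in S, (NormedSpace.exp (s • B) * Q * NormedSpace.exp (s • Bᵀ)) i j

/-- `Q_t = ∫_0^t e^{sB} Q e^{sB*} ds`, for finite `t > 0`. -/
def covariance (Q B : Matrix (Fin d) (Fin d) ℝ) (t : ℝ) : Matrix (Fin d) (Fin d) ℝ :=
  covarianceOn Q B (Ioc 0 t)

/-- `Q_∞ = ∫_0^∞ e^{sB} Q e^{sB*} ds`. -/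
def covarianceInf (Q B : Matrix (Fin d) (Fin d) ℝ) : Matrix (Fin d) (Fin d) ℝ :=
  covarianceOn Q B (Ioi 0)

/-- A matrix acting on `ℝ^d`. -/
abbrev act (A : Matrix (Fin d) (Fin d) ℝ) (x : Space d) : Space d :=
  Matrix.toEuclideanLin A x

/-- The density `(2π)^{-d/2} (det C)^{-1/2} exp (-⟨C⁻¹ x, x⟩ / 2)` of the centred Gaussian
measure with covariance `C`. -/
def gaussianDensity (C : Matrix (Fin d) (Fin d) ℝ) (x : Space d) : ℝ :=
  (2 * Real.pi) ^ (-(d : ℝ) / 2) * C.det ^ (-(1 / 2) : ℝ) *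
    Real.exp (-(1 / 2) * inner ℝ (act C⁻¹ x) x)

/-- The centred Gaussian measure on `ℝ^d` with (invertible) covariance `C`. -/
def gaussianMeasure (C : Matrix (Fin d) (Fin d) ℝ) : Measure (Space d) :=
  volume.withDensity fun x => ENNReal.ofReal (gaussianDensity C x)

/-- The invariant measure `γ_∞`. -/
def invariantMeasure (Q B : Matrix (Fin d) (Fin d) ℝ) : Measure (Space d) :=
  gaussianMeasure (covarianceInf Q B)

/-- The Ornstein–Uhlenbeck operators `H_t f(x) = ∫ f (e^{tB} x - y) dγ_t(y)`, `t > 0`. -/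
def semigroup {𝕜 : Type*} [RCLike 𝕜] (Q B : Matrix (Fin d) (Fin d) ℝ) (t : ℝ)
    (f : Space d → 𝕜) (x : Space d) : 𝕜 :=
  ∫ y, f (act (NormedSpace.exp (t • B)) x - y) ∂(gaussianMeasure (covariance Q B t))

/-- The kernel `h_t(x, y)`, `t > 0`, of `H_t` with respect to the invariant measure. -/
def kernel (Q B : Matrix (Fin d) (Fin d) ℝ) (t : ℝ) (x y : Space d) : ℝ :=
  (covarianceInf Q B * (covariance Q B t)⁻¹).det ^ (1 / 2 : ℝ) *
    Real.exp (-(1 / 2) *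
      (inner ℝ (act (covariance Q B t)⁻¹ (act (NormedSpace.exp (t • B)) x - y))
          (act (NormedSpace.exp (t • B)) x - y)
        - inner ℝ (act (covarianceInf Q B)⁻¹ y) y))

/-- The local region `|x - y| ≤ min (1, |x + y|⁻¹)`; the inverse is taken in `[0, ∞]`,
so that `0⁻¹ = ∞`. -/
def localRegion (d : ℕ) : Set (Space d × Space d) :=
  {p | ‖p.1 - p.2‖ₑ ≤ min 1 ‖p.1 + p.2‖ₑ⁻¹}

/-- The local part `h_t(x, y) 1_L(x, y)` of the kernel. -/
def localKernel (Q B : Matrix (Fin d) (Fin d) ℝ) (t : ℝ) (x y : Space d) : ℝ :=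
  (localRegion d).indicator (fun p => kernel Q B t p.1 p.2) (x, y)

/-- The local maximal operator
`H_*^loc f(x) = sup_{t > 0} |∫ h_t(x, y) 1_L(x, y) f(y) dγ_∞(y)|`, with values in `[0, ∞]`. -/
def localMaximal {𝕜 : Type*} [RCLike 𝕜] (Q B : Matrix (Fin d) (Fin d) ℝ)
    (f : Space d → 𝕜) (x : Space d) : ℝ≥0∞ :=
  ⨆ (t : ℝ) (_ : 0 < t), ‖∫ y, localKernel Q B t x y • f y ∂(invariantMeasure Q B)‖ₑ

/-- `T` is of weak type `1` with respect to `μ`: for a finite constant `C`,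
`μ {x | T f x > α} ≤ C ‖f‖₁ / α` for all `f ∈ L¹(μ)` and all `α > 0`
(and `T f` is measurable up to a null set). -/
def IsWeakTypeOne {X 𝕜 : Type*} [RCLike 𝕜] [MeasurableSpace X] (μ : Measure X)
    (T : (X → 𝕜) → X → ℝ≥0∞) : Prop :=
  ∃ C : ℝ≥0, ∀ f : X → 𝕜, Integrable f μ →
    AEMeasurable (T f) μ ∧
    ∀ α : ℝ≥0, 0 < α → μ {x | (α : ℝ≥0∞) < T f x} ≤ C * (∫⁻ x, ‖f x‖ₑ ∂μ) / α

theorem mem_localRegion_iff {x y : Space d} :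
    (x, y) ∈ localRegion d ↔ ‖x - y‖ ≤ 1 ∧ ‖x - y‖ * ‖x + y‖ ≤ 1 := by
  simp only [localRegion, mem_ofPred_eq, le_min_iff]
  refine and_congr ?_ ?_
  · rw [← ofReal_norm, ENNReal.ofReal_le_one]
  · rw [ENNReal.le_inv_iff_mul_le, ← ofReal_norm, ← ofReal_norm,
      ← ENNReal.ofReal_mul (norm_nonneg _), ENNReal.ofReal_le_one]

/-- `kernel` is the kernel of the semigroup with respect to the invariant measure. -/
theorem semigroup_eq_integral_kernel {𝕜 : Type*} [RCLike 𝕜] (Q B : Matrix (Fin d) (Fin d) ℝ)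
    (t : ℝ) (ht : 0 < (covariance Q B t).det) (hinf : 0 < (covarianceInf Q B).det)
    (f : Space d → 𝕜) (x : Space d) :
    semigroup Q B t f x = ∫ y, kernel Q B t x y • f y ∂(invariantMeasure Q B) := by
  have hm : ∀ C : Matrix (Fin d) (Fin d) ℝ, Measurable (gaussianDensity C) := by
    intro C
    have : Continuous (fun x : Space d => act C⁻¹ x) :=
      LinearMap.continuous_of_finiteDimensional _
    unfold gaussianDensity
    fun_prop
  have h0 : ∀ C : Matrix (Fin d) (Fin d) ℝ, 0 < C.det → ∀ x, 0 ≤ gaussianDensity C x := by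
    intro C hC x
    unfold gaussianDensity
    positivity
  have key : ∀ C : Matrix (Fin d) (Fin d) ℝ, 0 < C.det → ∀ g : Space d → 𝕜,
      ∫ y, g y ∂(gaussianMeasure C) = ∫ y, gaussianDensity C y • g y := by
    intro C hC g
    unfold gaussianMeasure
    rw [integral_withDensity_eq_integral_toReal_smul (hm C).ennreal_ofReal (by simp)]
    simp only [ENNReal.toReal_ofReal (h0 C hC _)]
  unfold semigroup invariantMeasure
  rw [key _ ht, key _ hinf,
    ← integral_sub_left_eq_self _ volume (act (NormedSpace.exp (t • B)) x)]
  refine integral_congr_ae (Filter.Eventually.of_forall fun y => ?_)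
  simp only [sub_sub_cancel, smul_smul]
  congr 1
  unfold gaussianDensity kernel
  rw [Matrix.det_mul, Matrix.det_nonsing_inv, Ring.inverse_eq_inv',
    Real.mul_rpow hinf.le (inv_nonneg.2 ht.le), Real.inv_rpow ht.le, Real.rpow_neg ht.le,
    Real.rpow_neg hinf.le]
  have := (Real.rpow_pos_of_pos hinf (1 / 2 : ℝ)).ne'
  rw [mul_sub, Real.exp_sub]
  field_simp

end OrnsteinUhlenbeck

end

/-!
The local part of the Ornstein–Uhlenbeck maximal operator is controlled by a Hardy–Littlewood
maximal function over balls so small that the Gaussian density is almost constant on them.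

Write `R(x) = ⟨Q_∞⁻¹ x, x⟩ / 2`, so that `γ_∞` has density a constant times `e^{-R}`. On the local
region `|x - y| (|x| + |y|) ≤ 2`, whence `R(x)` and `R(y)` differ by at most a constant. For `t ≤ 1`
the covariance `Q_t` is comparable to `t`, and `e^{tB} x - y = (x - y) + O(t |x|)` with
`|x - y| |x| ≤ 1`; so, with `τ = min (t, 1)`, the kernel satisfies
`h_t(x, y) ≤ K τ^{-d/2} e^{-c |x - y|² / τ} e^{R(x)}` there (`exists_kernel_le`). For `t ≥ 1` this
only says that `h_t(x, y) e^{-R(x)}` is bounded, which follows from `Q_t ≥ Q_1`.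

The section at `x` of the local region lies in the ball of radius `m(x) = 2 / (1 + |x|)`. Writing the
Gaussian factor as a superposition of indicators of balls bounds the operator at `x`, uniformly in
`t`, by the supremum over `r ≤ m(x)` of `r^{-d} e^{R(x)} ∫_{B(x, r)} |f| dγ_∞`
(`exists_lintegral_localKernel_le`). For such `r` the measure `γ_∞(B(x, 5r))` is at most a constant
times `r^d e^{-R(x)}` (`exists_gaussianMeasure_closedBall_le`), so the Vitali covering theorem
applied directly to `γ_∞` gives the weak type inequality
(`mul_measure_exists_lt_measure_closedBall_le`).

Stability of `B` enters through the convergence of the integral defining `Q_∞`, that is, the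
exponential decay of `e^{sB}` (`IsStable.exists_norm_exp_smul_le`). Measurability of the maximal
function comes from continuity in `t`, which reduces the supremum to rational times.
-/

noncomputable section

namespace OrnsteinUhlenbeck

open Filter Topology
open scoped Matrix.Norms.L2Operator

variable {d : ℕ}

/-! ### Exponentials of stable matrices -/

theorem continuous_exp_smul {𝔸 : Type*} [NormedRing 𝔸] [NormedAlgebra ℝ 𝔸] [CompleteSpace 𝔸]
    (A : 𝔸) :
    Continuous fun s : ℝ => NormedSpace.exp (s • A) :=
  continuous_iff_continuousAt.2 fun s => (hasDerivAt_exp_smul_const A s).continuousAt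

theorem exp_add_smul {𝕜 : Type*} [RCLike 𝕜] (A : Matrix (Fin d) (Fin d) 𝕜) (s t : ℝ) :
    NormedSpace.exp ((s + t) • A) = NormedSpace.exp (s • A) * NormedSpace.exp (t • A) := by
  rw [add_smul]
  exact Matrix.exp_add_of_commute _ _ (((Commute.refl A).smul_left s).smul_right t)

theorem exp_neg_smul_mul_exp_smul {𝕜 : Type*} [RCLike 𝕜] (A : Matrix (Fin d) (Fin d) 𝕜) (s : ℝ) :
    NormedSpace.exp ((-s) • A) * NormedSpace.exp (s • A) = 1 := by
  rw [← exp_add_smul]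
  simp

theorem exp_mulVec_of_eigenvector {A : Matrix (Fin d) (Fin d) ℂ} {v : Fin d → ℂ} {μ : ℂ}
    (hv : A *ᵥ v = μ • v) : NormedSpace.exp A *ᵥ v = Complex.exp μ • v := by
  have hpow : ∀ n : ℕ, (A ^ n) *ᵥ v = μ ^ n • v := by
    intro n
    induction n with
    | zero => simp
    | succ n ih => rw [pow_succ, ← Matrix.mulVec_mulVec, hv, Matrix.mulVec_smul, ih, smul_smul,
        pow_succ']
  let T : Matrix (Fin d) (Fin d) ℂ →ₗ[ℂ] (Fin d → ℂ) :=
    { toFun := fun M => M *ᵥ v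
      map_add' := fun M N => Matrix.add_mulVec M N v
      map_smul' := fun c M => Matrix.smul_mulVec c M v }
  have h1 := (NormedSpace.exp_series_hasSum_exp' (𝕂 := ℂ) A).mapL
    (LinearMap.toContinuousLinearMap T)
  have h2 := ((NormedSpace.exp_series_hasSum_exp' (𝕂 := ℂ) μ).smul_const v)
  rw [← Complex.exp_eq_exp_ℂ] at h2
  have e : (fun n : ℕ => LinearMap.toContinuousLinearMap T ((n.factorial : ℂ)⁻¹ • A ^ n))
      = fun n => ((n.factorial : ℂ)⁻¹ • μ ^ n) • v := by
    funext n
    rw [map_smul, smul_assoc, ← hpow]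
    rfl
  rw [e] at h1
  exact h1.unique h2

/-- Half of the spectral mapping theorem for the exponential of a matrix. It rests on `exp A` being
a polynomial in `A`, because the subalgebra generated by `A` is finite-dimensional, hence closed. -/
theorem spectrum_exp_subset (A : Matrix (Fin d) (Fin d) ℂ) :
    spectrum ℂ (NormedSpace.exp A) ⊆ Complex.exp '' spectrum ℂ A := by
  have hmem : NormedSpace.exp A ∈ Algebra.adjoin ℂ {A} := by
    refine NormedSpace.exp_mem (R := ℂ) ?_ (Algebra.self_mem_adjoin_singleton ℂ A)
    exact (Subalgebra.toSubmodule (Algebra.adjoin ℂ {A})).closed_of_finiteDimensional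
  rw [Algebra.adjoin_singleton_eq_range_aeval] at hmem
  obtain ⟨p, hp⟩ := hmem
  replace hp : Polynomial.aeval A p = NormedSpace.exp A := hp
  intro z hz
  have : Nontrivial (Matrix (Fin d) (Fin d) ℂ) := by
    by_contra h
    rw [not_nontrivial_iff_subsingleton] at h
    rw [spectrum.of_subsingleton] at hz
    exact hz
  rw [← hp, spectrum.map_polynomial_aeval] at hz
  obtain ⟨μ, hμ, rfl⟩ := hz
  refine ⟨μ, hμ, ?_⟩
  rw [← Matrix.spectrum_toLin', ← Module.End.hasEigenvalue_iff_mem_spectrum] at hμ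
  obtain ⟨v, hv⟩ := hμ.exists_hasEigenvector
  have h1 : A *ᵥ v = μ • v := by simpa using hv.apply_eq_smul
  have h2 := exp_mulVec_of_eigenvector h1
  have h3 : Polynomial.aeval A p *ᵥ v = p.eval μ • v := by
    have := Module.End.aeval_apply_of_hasEigenvector (p := p) hv
    rw [← this]
    have e : Matrix.toLin' (Polynomial.aeval A p) = Polynomial.aeval (Matrix.toLin' A) p :=
      (Polynomial.aeval_algHom_apply (Matrix.toLinAlgEquiv' (R := ℂ) (n := Fin d)) A p).symm
    rw [← e, Matrix.toLin'_apply]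
  rw [hp, h2] at h3
  exact smul_left_injective ℂ hv.2 h3

/-- Exponential decay of `e^{sA}`: by Gelfand's formula some power of `e^A` is a contraction. -/
theorem exists_norm_exp_smul_le_complex {A : Matrix (Fin d) (Fin d) ℂ}
    (hA : ∀ μ ∈ spectrum ℂ A, μ.re < 0) :
    ∃ K ε : ℝ, 0 < K ∧ 0 < ε ∧ ∀ s : ℝ, 0 ≤ s →
      ‖NormedSpace.exp (s • A)‖ ≤ K * Real.exp (-ε * s) := by
  obtain ⟨N, hN0, hN⟩ : ∃ N : ℕ, 0 < N ∧ ‖NormedSpace.exp A ^ N‖ < 1 := by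
    rcases subsingleton_or_nontrivial (Matrix (Fin d) (Fin d) ℂ) with h | h
    · exact ⟨1, one_pos, by rw [Subsingleton.elim (NormedSpace.exp A ^ 1) 0]; simp⟩
    have hr : spectralRadius ℂ (NormedSpace.exp A) < (1 : ℝ≥0) := by
      refine spectrum.spectralRadius_lt_of_forall_lt _ fun z hz => ?_
      obtain ⟨μ, hμ, rfl⟩ := spectrum_exp_subset A hz
      rw [← NNReal.coe_lt_coe, coe_nnnorm, Complex.norm_exp, NNReal.coe_one, Real.exp_lt_one_iff]
      exact hA μ hμ
    have := (spectrum.pow_nnnorm_pow_one_div_tendsto_nhds_spectralRadius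
      (NormedSpace.exp A)).eventually_lt_const hr
    obtain ⟨N, h1, h2⟩ := (this.and (eventually_gt_atTop 0)).exists
    refine ⟨N, h2, ?_⟩
    by_contra! hc
    refine absurd h1 (not_lt.2 ?_)
    have : (1 : ℝ≥0∞) ≤ (‖NormedSpace.exp A ^ N‖₊ : ℝ≥0∞) := by
      rw [ENNReal.one_le_coe_iff]
      exact_mod_cast hc
    simpa using ENNReal.one_le_rpow this (by positivity : (0 : ℝ) < 1 / N)
  have hNr : (0 : ℝ) < N := by exact_mod_cast hN0
  -- The norm may vanish; a positive `q` is needed for `log q`.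
  set q : ℝ := max ‖NormedSpace.exp A ^ N‖ (1 / 2) with hq
  have hq0 : 0 < q := lt_of_lt_of_le (by norm_num) (le_max_right _ _)
  have hq1 : q < 1 := max_lt hN (by norm_num)
  obtain ⟨M, hM⟩ := (isCompact_Icc (a := (0 : ℝ)) (b := N)).exists_bound_of_continuousOn
    (continuous_exp_smul A).continuousOn
  have hM0 : 0 ≤ M := (norm_nonneg _).trans (hM 0 ⟨le_rfl, hNr.le⟩)
  have hlog : Real.log q < 0 := Real.log_neg hq0 hq1
  refine ⟨(M + 1) / q, -Real.log q / N, by positivity, div_pos (by linarith) hNr, fun s hs => ?_⟩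
  set n := ⌊s / N⌋₊ with hn
  have hn1 : (n : ℝ) ≤ s / N := Nat.floor_le (by positivity)
  have hn2 : s / N < n + 1 := Nat.lt_floor_add_one _
  have hsplit : NormedSpace.exp (s • A)
      = (NormedSpace.exp A ^ N) ^ n * NormedSpace.exp ((s - n * N) • A) := by
    rw [← pow_mul, ← Matrix.exp_nsmul, ← Nat.cast_smul_eq_nsmul ℝ, ← exp_add_smul]
    congr 2
    push_cast
    ring
  have hpow : ‖(NormedSpace.exp A ^ N) ^ n‖ ≤ q ^ n := by
    rcases Nat.eq_zero_or_pos n with h0 | h0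
    · rcases subsingleton_or_nontrivial (Matrix (Fin d) (Fin d) ℂ) with h | h
      · rw [Subsingleton.elim ((NormedSpace.exp A ^ N) ^ n) 0, norm_zero]; positivity
      · simp [h0]
    · exact (norm_pow_le' _ h0).trans (by gcongr; exact le_max_left _ _)
  have hqn : q ^ n ≤ 1 / q * Real.exp (-(-Real.log q / N) * s) := by
    rw [← Real.exp_log hq0, ← Real.exp_nat_mul, one_div, ← Real.exp_neg, ← Real.exp_add,
      Real.exp_le_exp, Real.log_exp]
    have : -(-Real.log q / N) * s = Real.log q * (s / N) := by ring
    rw [this]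
    nlinarith
  have h3 : ‖NormedSpace.exp ((s - n * N) • A)‖ ≤ M + 1 := by
    refine (hM _ ⟨?_, ?_⟩).trans (by linarith)
    · rw [le_div_iff₀ hNr] at hn1; linarith
    · rw [div_lt_iff₀ hNr] at hn2; linarith
  rw [hsplit]
  calc _ ≤ ‖(NormedSpace.exp A ^ N) ^ n‖ * ‖NormedSpace.exp ((s - n * N) • A)‖ := norm_mul_le _ _
    _ ≤ (1 / q * Real.exp (-(-Real.log q / N) * s)) * (M + 1) := by
        gcongr; exact hpow.trans hqn
    _ = _ := by ring

theorem exp_smul_map_algebraMap (B : Matrix (Fin d) (Fin d) ℝ) (s : ℝ) :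
    (NormedSpace.exp (s • B)).map (algebraMap ℝ ℂ)
      = NormedSpace.exp (s • B.map (algebraMap ℝ ℂ)) := by
  let _ : NormedAlgebra ℚ (Matrix (Fin d) (Fin d) ℝ) := NormedAlgebra.restrictScalars ℚ ℝ _
  have := NormedSpace.map_exp ((algebraMap ℝ ℂ).mapMatrix (m := Fin d))
    (Continuous.matrix_map continuous_id Complex.continuous_ofReal) (s • B)
  rw [RingHom.mapMatrix_apply, RingHom.mapMatrix_apply] at this
  rw [this]
  congr 1
  ext i j
  simp

/-- Exponential decay of `e^{sB}` for a stable real matrix `B`, as the real part of the complex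
case. -/
theorem IsStable.exists_norm_exp_smul_le {B : Matrix (Fin d) (Fin d) ℝ} (hB : IsStable B) :
    ∃ K ε : ℝ, 0 < K ∧ 0 < ε ∧ ∀ s : ℝ, 0 ≤ s →
      ‖NormedSpace.exp (s • B)‖ ≤ K * Real.exp (-ε * s) := by
  obtain ⟨K, ε, hK, hε, h⟩ := exists_norm_exp_smul_le_complex hB
  let T : Matrix (Fin d) (Fin d) ℂ →ₗ[ℝ] Matrix (Fin d) (Fin d) ℝ := Complex.reLm.mapMatrix
  refine ⟨(‖LinearMap.toContinuousLinearMap T‖ + 1) * K, ε, by positivity, hε, fun s hs => ?_⟩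
  have e : NormedSpace.exp (s • B)
      = LinearMap.toContinuousLinearMap T (NormedSpace.exp (s • B.map (algebraMap ℝ ℂ))) := by
    rw [← exp_smul_map_algebraMap]
    ext i j
    simp [T]
  rw [e, mul_assoc]
  refine (ContinuousLinearMap.le_opNorm _ _).trans ?_
  gcongr
  · linarith
  · exact h s hs

theorem norm_act_le (A : Matrix (Fin d) (Fin d) ℝ) (x : Space d) : ‖act A x‖ ≤ ‖A‖ * ‖x‖ :=
  Matrix.l2_opNorm_mulVec A x

theorem act_mul (A A' : Matrix (Fin d) (Fin d) ℝ) (x : Space d) :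
    act (A * A') x = act A (act A' x) := by
  simp [act, Matrix.toLpLin_apply]

/-- `e^{tB} - 1 = O(t)` on bounded time intervals. -/
theorem exists_norm_exp_smul_sub_one_le (B : Matrix (Fin d) (Fin d) ℝ) :
    ∃ K : ℝ, 0 < K ∧ ∀ t ∈ Icc (0 : ℝ) 1, ‖NormedSpace.exp (t • B) - 1‖ ≤ K * t := by
  obtain ⟨M, hM⟩ := (isCompact_Icc (a := (0 : ℝ)) (b := 1)).exists_bound_of_continuousOn
    ((continuous_exp_smul B).mul (continuous_const (y := B))).continuousOn
  have hM0 : 0 ≤ M := (norm_nonneg _).trans (hM 0 ⟨le_rfl, zero_le_one⟩)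
  refine ⟨M + 1, by positivity, fun t ht => ?_⟩
  have := norm_image_sub_le_of_norm_deriv_le_segment'
    (fun s _ => (hasDerivAt_exp_smul_const B s).hasDerivWithinAt)
    (fun s hs => hM s (Ico_subset_Icc_self hs)) t ht
  simp only [zero_smul, NormedSpace.exp_zero, sub_zero] at this
  exact this.trans (by gcongr; exacts [ht.1, by linarith])

/-! ### The covariance matrices -/

theorem inner_act_eq_dotProduct (A : Matrix (Fin d) (Fin d) ℝ) (x y : Space d) :
    inner ℝ (act A x) y = y.ofLp ⬝ᵥ A *ᵥ x.ofLp := by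
  rw [real_inner_comm]
  exact Matrix.inner_toEuclideanCLM A y x

theorem inner_act_left (A : Matrix (Fin d) (Fin d) ℝ) (x y : Space d) :
    inner ℝ (act A x) y = inner ℝ x (act Aᵀ y) := by
  rw [inner_act_eq_dotProduct, real_inner_comm, inner_act_eq_dotProduct,
    Matrix.dotProduct_mulVec, Matrix.dotProduct_mulVec, Matrix.vecMul_transpose,
    ← Matrix.dotProduct_mulVec, dotProduct_comm]

theorem inner_act_self_le (A : Matrix (Fin d) (Fin d) ℝ) (x : Space d) :
    inner ℝ (act A x) x ≤ ‖A‖ * ‖x‖ ^ 2 := by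
  refine (real_inner_le_norm _ _).trans ?_
  nlinarith [norm_act_le A x, norm_nonneg x]

theorem continuous_act (A : Matrix (Fin d) (Fin d) ℝ) : Continuous (act A) :=
  LinearMap.continuous_of_finiteDimensional _

/-- A positive definite quadratic form is coercive. -/
theorem exists_le_inner_act_of_posDef {A : Matrix (Fin d) (Fin d) ℝ} (hA : A.PosDef) :
    ∃ c : ℝ, 0 < c ∧ ∀ x : Space d, c * ‖x‖ ^ 2 ≤ inner ℝ (act A x) x := by
  have hpos : ∀ x : Space d, x ≠ 0 → 0 < inner ℝ (act A x) x := by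
    intro x hx
    rw [inner_act_eq_dotProduct]
    have hx' : x.ofLp ≠ 0 := by simpa using hx
    simpa using hA.dotProduct_mulVec_pos hx'
  have hcont : Continuous fun x : Space d => inner ℝ (act A x) x :=
    (continuous_act A).inner continuous_id
  rcases (Metric.sphere (0 : Space d) 1).eq_empty_or_nonempty with h | h
  · refine ⟨1, one_pos, fun x => ?_⟩
    have hx : x = 0 := by
      by_contra hx
      have h1 : (‖x‖⁻¹ : ℝ) • x ∈ Metric.sphere (0 : Space d) 1 := by simp [norm_smul, hx]
      rw [h] at h1
      exact h1
    simp [hx]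
  · obtain ⟨u, hu, hmin⟩ := (isCompact_sphere (0 : Space d) 1).exists_isMinOn h hcont.continuousOn
    have hu0 : u ≠ 0 := by
      rintro rfl
      simp at hu
    refine ⟨_, hpos u hu0, fun x => ?_⟩
    rcases eq_or_ne x 0 with rfl | hx
    · simp
    have hx0 : ‖x‖ ≠ 0 := norm_ne_zero_iff.2 hx
    have h1 : (‖x‖⁻¹ : ℝ) • x ∈ Metric.sphere (0 : Space d) 1 := by simp [norm_smul, hx]
    have h2 : inner ℝ (act A u) u ≤ inner ℝ (act A ((‖x‖⁻¹ : ℝ) • x)) ((‖x‖⁻¹ : ℝ) • x) := hmin h1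
    rw [show act A ((‖x‖⁻¹ : ℝ) • x) = (‖x‖⁻¹ : ℝ) • act A x from map_smul _ _ _,
      real_inner_smul_left, real_inner_smul_right] at h2
    have h3 := mul_le_mul_of_nonneg_right h2 (sq_nonneg ‖x‖)
    refine h3.trans_eq ?_
    field_simp

theorem posDef_of_le_inner_act {A : Matrix (Fin d) (Fin d) ℝ} (hs : Aᵀ = A) {c : ℝ} (hc : 0 < c)
    (h : ∀ x : Space d, c * ‖x‖ ^ 2 ≤ inner ℝ (act A x) x) : A.PosDef := by
  refine Matrix.PosDef.of_dotProduct_mulVec_pos (by simpa [Matrix.IsHermitian] using hs)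
    fun x hx => ?_
  have := h (WithLp.toLp 2 x)
  rw [inner_act_eq_dotProduct] at this
  refine lt_of_lt_of_le ?_ this
  have : ‖(WithLp.toLp 2 x : Space d)‖ ≠ 0 := by simpa using hx
  positivity

theorem pow_le_det_of_le_inner_act {A : Matrix (Fin d) (Fin d) ℝ} (hs : Aᵀ = A) {c : ℝ}
    (hc : 0 ≤ c) (h : ∀ x : Space d, c * ‖x‖ ^ 2 ≤ inner ℝ (act A x) x) : c ^ d ≤ A.det := by
  have hA : A.IsHermitian := by simpa [Matrix.IsHermitian] using hs
  rw [hA.det_eq_prod_eigenvalues]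
  have : ∀ i, c ≤ hA.eigenvalues i := by
    intro i
    have h1 := h (hA.eigenvectorBasis i)
    rw [inner_act_eq_dotProduct, hA.eigenvectorBasis.norm_eq_one] at h1
    rw [hA.eigenvalues_eq]
    simpa using h1
  calc c ^ d = ∏ _i : Fin d, c := by simp
    _ ≤ _ := Finset.prod_le_prod (fun _ _ => hc) fun i _ => this i

/-- If a symmetric positive definite `A` satisfies `A ≤ C`, then `A⁻¹ ≥ C⁻¹`. -/
theorem le_inner_act_inv {A : Matrix (Fin d) (Fin d) ℝ} (hA : A.PosDef) {C : ℝ} (hC : 0 < C)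
    (h : ∀ x : Space d, inner ℝ (act A x) x ≤ C * ‖x‖ ^ 2) (w : Space d) :
    C⁻¹ * ‖w‖ ^ 2 ≤ inner ℝ (act A⁻¹ w) w := by
  have hs : Aᵀ = A := by simpa [Matrix.IsHermitian] using hA.isHermitian
  have hw : act A (act A⁻¹ w) = w := by
    rw [← act_mul, Matrix.mul_nonsing_inv _ (isUnit_iff_ne_zero.2 hA.det_pos.ne')]
    simp [act]
  set u := act A⁻¹ w
  -- Expand the nonnegative quantity `⟨A (u - C⁻¹ w), u - C⁻¹ w⟩`.
  have h0 : 0 ≤ inner ℝ (act A (u - C⁻¹ • w)) (u - C⁻¹ • w) := by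
    obtain ⟨c, hc, hc'⟩ := exists_le_inner_act_of_posDef hA
    exact le_trans (by positivity) (hc' _)
  have h1 : inner ℝ (act A w) u = ‖w‖ ^ 2 := by
    rw [inner_act_left, hs, hw, real_inner_self_eq_norm_sq]
  have h2 := h w
  rw [act, map_sub, map_smul] at h0
  change 0 ≤ inner ℝ (act A u - C⁻¹ • act A w) (u - C⁻¹ • w) at h0
  rw [hw, inner_sub_left, inner_sub_right, inner_sub_right, real_inner_smul_left,
    real_inner_smul_left, real_inner_smul_right, real_inner_smul_right, h1,
    real_inner_self_eq_norm_sq, real_inner_comm] at h0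
  have h3 : C⁻¹ * (C⁻¹ * inner ℝ (act A w) w) ≤ C⁻¹ * ‖w‖ ^ 2 := by
    have : C⁻¹ * inner ℝ (act A w) w ≤ C⁻¹ * (C * ‖w‖ ^ 2) := by gcongr
    rw [inv_mul_cancel_left₀ hC.ne'] at this
    gcongr
  linarith

/-- The integrand `e^{sB} Q e^{sB*}` of the covariance matrices. -/
def covarianceIntegrand (Q B : Matrix (Fin d) (Fin d) ℝ) (s : ℝ) : Matrix (Fin d) (Fin d) ℝ :=
  NormedSpace.exp (s • B) * Q * NormedSpace.exp (s • Bᵀ)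

theorem exp_smul_transpose (B : Matrix (Fin d) (Fin d) ℝ) (s : ℝ) :
    NormedSpace.exp (s • Bᵀ) = (NormedSpace.exp (s • B))ᵀ := by
  rw [← Matrix.transpose_smul, Matrix.exp_transpose]

theorem norm_exp_smul_transpose (B : Matrix (Fin d) (Fin d) ℝ) (s : ℝ) :
    ‖NormedSpace.exp (s • Bᵀ)‖ = ‖NormedSpace.exp (s • B)‖ := by
  rw [exp_smul_transpose, ← Matrix.conjTranspose_eq_transpose_of_trivial,
    Matrix.l2_opNorm_conjTranspose]

theorem continuous_covarianceIntegrand (Q B : Matrix (Fin d) (Fin d) ℝ) :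
    Continuous (covarianceIntegrand Q B) :=
  ((continuous_exp_smul B).mul continuous_const).mul (continuous_exp_smul Bᵀ)

theorem inner_act_covarianceIntegrand (Q B : Matrix (Fin d) (Fin d) ℝ) (s : ℝ) (x : Space d) :
    inner ℝ (act (covarianceIntegrand Q B s) x) x
      = inner ℝ (act Q (act (NormedSpace.exp (s • Bᵀ)) x)) (act (NormedSpace.exp (s • Bᵀ)) x) := by
  rw [covarianceIntegrand, act_mul, act_mul, inner_act_left, ← exp_smul_transpose]

theorem transpose_covarianceIntegrand {Q : Matrix (Fin d) (Fin d) ℝ} (hQ : Qᵀ = Q)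
    (B : Matrix (Fin d) (Fin d) ℝ) (s : ℝ) :
    (covarianceIntegrand Q B s)ᵀ = covarianceIntegrand Q B s := by
  rw [covarianceIntegrand, exp_smul_transpose, Matrix.transpose_mul, Matrix.transpose_mul,
    Matrix.transpose_transpose, hQ, mul_assoc]

theorem transpose_covarianceOn {Q : Matrix (Fin d) (Fin d) ℝ} (hQ : Qᵀ = Q)
    (B : Matrix (Fin d) (Fin d) ℝ) (S : Set ℝ) :
    (covarianceOn Q B S)ᵀ = covarianceOn Q B S := by
  ext i j
  refine integral_congr_ae (Eventually.of_forall fun s => ?_)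
  exact congrFun (congrFun (transpose_covarianceIntegrand hQ B s) i) j

theorem integrableOn_covarianceIntegrand_Ioc (Q B : Matrix (Fin d) (Fin d) ℝ) (t : ℝ) :
    IntegrableOn (covarianceIntegrand Q B) (Ioc 0 t) :=
  (continuous_covarianceIntegrand Q B).integrableOn_Ioc

theorem integrableOn_covarianceIntegrand_Ioi (Q : Matrix (Fin d) (Fin d) ℝ)
    {B : Matrix (Fin d) (Fin d) ℝ} (hB : IsStable B) :
    IntegrableOn (covarianceIntegrand Q B) (Ioi 0) := by
  obtain ⟨K, ε, hK, hε, h⟩ := hB.exists_norm_exp_smul_le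
  have h1 : IntegrableOn (fun s : ℝ => K * ‖Q‖ * K * Real.exp (-(2 * ε) * s)) (Ioi 0) :=
    (exp_neg_integrableOn_Ioi 0 (by positivity)).const_mul _
  refine Integrable.mono' h1
    (continuous_covarianceIntegrand Q B).aestronglyMeasurable.restrict ?_
  filter_upwards [ae_restrict_mem measurableSet_Ioi] with s hs
  have hs' := h s (le_of_lt hs)
  calc ‖covarianceIntegrand Q B s‖
      ≤ ‖NormedSpace.exp (s • B)‖ * ‖Q‖ * ‖NormedSpace.exp (s • Bᵀ)‖ := by
        refine (norm_mul_le _ _).trans ?_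
        gcongr
        exact norm_mul_le _ _
    _ ≤ (K * Real.exp (-ε * s)) * ‖Q‖ * (K * Real.exp (-ε * s)) := by
        rw [norm_exp_smul_transpose]
        gcongr
    _ = K * ‖Q‖ * K * Real.exp (-(2 * ε) * s) := by
        rw [show -(2 * ε) * s = -ε * s + -ε * s by ring, Real.exp_add]
        ring

theorem covarianceOn_eq_integral {Q B : Matrix (Fin d) (Fin d) ℝ} {S : Set ℝ}
    (h : IntegrableOn (covarianceIntegrand Q B) S) :
    covarianceOn Q B S = ∫ s in S, covarianceIntegrand Q B s := by
  ext i j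
  exact ContinuousLinearMap.integral_comp_comm
    (LinearMap.toContinuousLinearMap (Matrix.entryLinearMap ℝ ℝ i j)) h

theorem inner_act_covarianceOn {Q B : Matrix (Fin d) (Fin d) ℝ} {S : Set ℝ}
    (h : IntegrableOn (covarianceIntegrand Q B) S) (x : Space d) :
    IntegrableOn (fun s => inner ℝ (act (covarianceIntegrand Q B s) x) x) S ∧
    inner ℝ (act (covarianceOn Q B S) x) x
      = ∫ s in S, inner ℝ (act (covarianceIntegrand Q B s) x) x := by
  let T : Matrix (Fin d) (Fin d) ℝ →ₗ[ℝ] ℝ :=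
    { toFun := fun A => inner ℝ (act A x) x
      map_add' := fun A A' => by simp [act, inner_add_left]
      map_smul' := fun c A => by simp [act, real_inner_smul_left] }
  refine ⟨(LinearMap.toContinuousLinearMap T).integrable_comp h, ?_⟩
  rw [covarianceOn_eq_integral h]
  exact (ContinuousLinearMap.integral_comp_comm (LinearMap.toContinuousLinearMap T) h).symm

/-- `Q_t ≥ c min (t, 1)` for all `0 < t ≤ ∞`, with a common `c > 0`. -/
theorem exists_le_inner_act_covarianceOn {Q : Matrix (Fin d) (Fin d) ℝ} (hQ : Q.PosDef)
    (B : Matrix (Fin d) (Fin d) ℝ) :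
    ∃ c : ℝ, 0 < c ∧ ∀ (S : Set ℝ) (τ : ℝ), 0 ≤ τ → τ ≤ 1 → Ioc 0 τ ⊆ S →
      IntegrableOn (covarianceIntegrand Q B) S → ∀ x : Space d,
        c * τ * ‖x‖ ^ 2 ≤ inner ℝ (act (covarianceOn Q B S) x) x := by
  obtain ⟨c, hc, hcQ⟩ := exists_le_inner_act_of_posDef hQ
  obtain ⟨M, hM⟩ := (isCompact_Icc (a := (0 : ℝ)) (b := 1)).exists_bound_of_continuousOn
    ((continuous_exp_smul Bᵀ).comp continuous_neg).continuousOn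
  have hM0 : 0 ≤ M := (norm_nonneg _).trans (hM 0 ⟨le_rfl, zero_le_one⟩)
  refine ⟨c / (M + 1) ^ 2, by positivity, fun S τ hτ0 hτ hS hint x => ?_⟩
  have hnn : ∀ s, 0 ≤ inner ℝ (act (covarianceIntegrand Q B s) x) x := fun s => by
    rw [inner_act_covarianceIntegrand]
    exact le_trans (by positivity) (hcQ _)
  have hlow : ∀ s ∈ Ioc 0 τ,
      c / (M + 1) ^ 2 * ‖x‖ ^ 2 ≤ inner ℝ (act (covarianceIntegrand Q B s) x) x := by
    intro s hs
    rw [inner_act_covarianceIntegrand]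
    refine le_trans ?_ (hcQ _)
    have h1 : ‖x‖ ≤ (M + 1) * ‖act (NormedSpace.exp (s • Bᵀ)) x‖ := by
      have e : x = act (NormedSpace.exp ((-s) • Bᵀ)) (act (NormedSpace.exp (s • Bᵀ)) x) := by
        rw [← act_mul, exp_neg_smul_mul_exp_smul]
        simp [act]
      calc ‖x‖ = ‖act (NormedSpace.exp ((-s) • Bᵀ)) (act (NormedSpace.exp (s • Bᵀ)) x)‖ := by
            rw [← e]
        _ ≤ _ := norm_act_le _ _
        _ ≤ _ := by
            gcongr
            exact (hM s ⟨hs.1.le, hs.2.trans hτ⟩).trans (by linarith)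
    rw [div_mul_eq_mul_div, div_le_iff₀ (by positivity)]
    have h2 := pow_le_pow_left₀ (norm_nonneg x) h1 2
    rw [mul_pow] at h2
    nlinarith
  obtain ⟨hint', heq⟩ := inner_act_covarianceOn hint x
  rw [heq]
  calc c / (M + 1) ^ 2 * τ * ‖x‖ ^ 2 = ∫ _s in Ioc 0 τ, c / (M + 1) ^ 2 * ‖x‖ ^ 2 := by
        simp [hτ0]
        ring
    _ ≤ ∫ s in Ioc 0 τ, inner ℝ (act (covarianceIntegrand Q B s) x) x :=
        setIntegral_mono_on (integrableOn_const (by simp)) (hint'.mono_set hS) measurableSet_Ioc hlow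
    _ ≤ _ := setIntegral_mono_set hint' (Eventually.of_forall hnn) hS.eventuallyLE

/-- `Q_t ≤ C t` for `0 < t ≤ 1`. -/
theorem exists_inner_act_covariance_le (Q B : Matrix (Fin d) (Fin d) ℝ) :
    ∃ C : ℝ, 0 < C ∧ ∀ t : ℝ, 0 ≤ t → t ≤ 1 → ∀ x : Space d,
      inner ℝ (act (covariance Q B t) x) x ≤ C * t * ‖x‖ ^ 2 := by
  obtain ⟨M, hM⟩ := (isCompact_Icc (a := (0 : ℝ)) (b := 1)).exists_bound_of_continuousOn
    (continuous_covarianceIntegrand Q B).continuousOn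
  have hM0 : 0 ≤ M := (norm_nonneg _).trans (hM 0 ⟨le_rfl, zero_le_one⟩)
  refine ⟨M + 1, by positivity, fun t ht0 ht x => ?_⟩
  obtain ⟨hint, heq⟩ := inner_act_covarianceOn (integrableOn_covarianceIntegrand_Ioc Q B t) x
  rw [covariance, heq]
  calc _ ≤ ∫ _s in Ioc 0 t, (M + 1) * ‖x‖ ^ 2 := by
        refine setIntegral_mono_on hint (integrableOn_const (by simp)) measurableSet_Ioc fun s hs => ?_
        refine (inner_act_self_le _ _).trans ?_
        gcongr
        exact (hM s ⟨hs.1.le, hs.2.trans ht⟩).trans (by linarith)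
    _ = _ := by
        simp [ht0]
        ring

theorem posDef_covariance {Q : Matrix (Fin d) (Fin d) ℝ} (hQ : Q.PosDef)
    (B : Matrix (Fin d) (Fin d) ℝ) {t : ℝ} (ht : 0 < t) : (covariance Q B t).PosDef := by
  obtain ⟨c, hc, h⟩ := exists_le_inner_act_covarianceOn hQ B
  have hs : Qᵀ = Q := by simpa [Matrix.IsHermitian] using hQ.isHermitian
  have hτ : 0 < min t 1 := lt_min ht one_pos
  exact posDef_of_le_inner_act (transpose_covarianceOn hs B _) (mul_pos hc hτ)
    (h _ (min t 1) hτ.le (min_le_right _ _) (Ioc_subset_Ioc_right (min_le_left _ _))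
      (integrableOn_covarianceIntegrand_Ioc Q B t))

theorem posDef_covarianceInf {Q B : Matrix (Fin d) (Fin d) ℝ} (hQ : Q.PosDef)
    (hB : IsStable B) : (covarianceInf Q B).PosDef := by
  obtain ⟨c, hc, h⟩ := exists_le_inner_act_covarianceOn hQ B
  have hs : Qᵀ = Q := by simpa [Matrix.IsHermitian] using hQ.isHermitian
  exact posDef_of_le_inner_act (transpose_covarianceOn hs B _) (mul_pos hc one_pos)
    (h _ 1 zero_le_one le_rfl Ioc_subset_Ioi_self (integrableOn_covarianceIntegrand_Ioi Q hB))

/-- `det Q_t` is at least of order `min (t, 1) ^ d`. -/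
theorem exists_pow_le_det_covariance {Q : Matrix (Fin d) (Fin d) ℝ} (hQ : Q.PosDef)
    (B : Matrix (Fin d) (Fin d) ℝ) :
    ∃ c : ℝ, 0 < c ∧ ∀ t : ℝ, 0 < t → (c * min t 1) ^ d ≤ (covariance Q B t).det := by
  obtain ⟨c, hc, h⟩ := exists_le_inner_act_covarianceOn hQ B
  have hs : Qᵀ = Q := by simpa [Matrix.IsHermitian] using hQ.isHermitian
  refine ⟨c, hc, fun t ht => ?_⟩
  have hτ : 0 < min t 1 := lt_min ht one_pos
  exact pow_le_det_of_le_inner_act (transpose_covarianceOn hs B _) (mul_pos hc hτ).le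
    (h _ (min t 1) hτ.le (min_le_right _ _) (Ioc_subset_Ioc_right (min_le_left _ _))
      (integrableOn_covarianceIntegrand_Ioc Q B t))

theorem continuousOn_covariance (Q B : Matrix (Fin d) (Fin d) ℝ) :
    ContinuousOn (covariance Q B) (Ioi 0) := by
  have h : Continuous fun t : ℝ => ∫ s in (0 : ℝ)..t, covarianceIntegrand Q B s :=
    intervalIntegral.continuous_primitive
      (fun a b => (continuous_covarianceIntegrand Q B).intervalIntegrable a b) 0
  refine h.continuousOn.congr fun t ht => ?_
  change _ = ∫ s in (0 : ℝ)..t, covarianceIntegrand Q B s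
  rw [covariance, covarianceOn_eq_integral (integrableOn_covarianceIntegrand_Ioc Q B t),
    intervalIntegral.integral_of_le (le_of_lt ht)]

theorem continuousOn_covariance_inv {Q : Matrix (Fin d) (Fin d) ℝ} (hQ : Q.PosDef)
    (B : Matrix (Fin d) (Fin d) ℝ) :
    ContinuousOn (fun t => (covariance Q B t)⁻¹) (Ioi 0) := by
  have h := continuousOn_covariance Q B
  simp only [Matrix.inv_def, Ring.inverse_eq_inv']
  refine ContinuousOn.smul (ContinuousOn.inv₀ ?_
    fun t ht => (posDef_covariance hQ B ht).det_pos.ne') ?_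
  · exact (continuous_id.matrix_det).comp_continuousOn h
  · exact (continuous_id.matrix_adjugate).comp_continuousOn h

/-! ### The kernel on the local region -/

/-- The quadratic potential `R(x) = ⟨C⁻¹ x, x⟩ / 2` of the centred Gaussian with covariance `C`. -/
def potential (C : Matrix (Fin d) (Fin d) ℝ) (x : Space d) : ℝ :=
  1 / 2 * inner ℝ (act C⁻¹ x) x

/-- The radius `2 / (1 + |x|)` of a ball around `x` that contains the section at `x` of the local
region, and on which the Gaussian density is comparable to its value at `x`. -/
def localRadius (x : Space d) : ℝ := 2 / (1 + ‖x‖)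

theorem localRadius_pos (x : Space d) : 0 < localRadius x := by
  unfold localRadius
  positivity

theorem localRadius_le_two (x : Space d) : localRadius x ≤ 2 :=
  div_le_self zero_le_two (by linarith [norm_nonneg x])

theorem potential_sub_le (C : Matrix (Fin d) (Fin d) ℝ) (x y : Space d) :
    potential C x - potential C y ≤ 1 / 2 * (‖C⁻¹‖ * (‖x - y‖ * (‖x‖ + ‖y‖))) := by
  have e : potential C x - potential C y
      = 1 / 2 * (inner ℝ (act C⁻¹ (x - y)) x + inner ℝ (act C⁻¹ y) (x - y)) := by
    rw [show act C⁻¹ (x - y) = act C⁻¹ x - act C⁻¹ y from map_sub _ _ _, inner_sub_left,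
      inner_sub_right, potential, potential]
    ring
  have h1 : inner ℝ (act C⁻¹ (x - y)) x ≤ ‖C⁻¹‖ * ‖x - y‖ * ‖x‖ :=
    (real_inner_le_norm _ _).trans (by gcongr; exact norm_act_le _ _)
  have h2 : inner ℝ (act C⁻¹ y) (x - y) ≤ ‖C⁻¹‖ * ‖y‖ * ‖x - y‖ :=
    (real_inner_le_norm _ _).trans (by gcongr; exact norm_act_le _ _)
  rw [e]
  nlinarith

section LocalRegion

variable {x y : Space d}

theorem two_mul_norm_le (x y : Space d) : 2 * ‖x‖ ≤ ‖x + y‖ + ‖x - y‖ := by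
  calc 2 * ‖x‖ = ‖(x + y) + (x - y)‖ := by
        rw [add_add_sub_cancel, ← two_smul ℝ x, norm_smul, Real.norm_two]
    _ ≤ _ := norm_add_le _ _

theorem norm_add_norm_le (x y : Space d) : ‖x‖ + ‖y‖ ≤ ‖x + y‖ + ‖x - y‖ := by
  have h := two_mul_norm_le y x
  rw [add_comm y x, norm_sub_rev] at h
  linarith [two_mul_norm_le x y]

theorem norm_sub_mul_norm_add_norm_le (h : (x, y) ∈ localRegion d) :
    ‖x - y‖ * (‖x‖ + ‖y‖) ≤ 2 := by
  obtain ⟨h1, h2⟩ := mem_localRegion_iff.1 h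
  nlinarith [norm_add_norm_le x y, norm_nonneg (x - y)]

theorem norm_sub_mul_norm_le (h : (x, y) ∈ localRegion d) : ‖x - y‖ * ‖x‖ ≤ 1 := by
  obtain ⟨h1, h2⟩ := mem_localRegion_iff.1 h
  nlinarith [mul_le_mul_of_nonneg_left (two_mul_norm_le x y) (norm_nonneg (x - y)),
    norm_nonneg (x - y)]

theorem mem_closedBall_of_mem_localRegion (h : (x, y) ∈ localRegion d) :
    y ∈ Metric.closedBall x (localRadius x) := by
  rw [Metric.mem_closedBall', dist_eq_norm, localRadius,
    le_div_iff₀ (by linarith [norm_nonneg x])]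
  have := norm_sub_mul_norm_le h
  have := (mem_localRegion_iff.1 h).1
  linarith

theorem potential_le_of_mem_localRegion (C : Matrix (Fin d) (Fin d) ℝ)
    (h : (x, y) ∈ localRegion d) : potential C y ≤ potential C x + ‖C⁻¹‖ := by
  have h1 := potential_sub_le C y x
  rw [norm_sub_rev, add_comm ‖y‖] at h1
  nlinarith [norm_sub_mul_norm_add_norm_le h, norm_nonneg C⁻¹]

end LocalRegion

/-- The Gaussian density at points of the fivefold dilation of a local ball is at most a constant
times its value at the centre. -/
theorem potential_le_of_mem_closedBall (C : Matrix (Fin d) (Fin d) ℝ) {x y : Space d} {r : ℝ}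
    (hr : r ≤ localRadius x) (hy : y ∈ Metric.closedBall x (5 * r)) :
    potential C x ≤ potential C y + 60 * ‖C⁻¹‖ := by
  rw [Metric.mem_closedBall', dist_eq_norm] at hy
  have h0 := norm_nonneg x
  have h1 : ‖x - y‖ * (1 + ‖x‖) ≤ 10 := by
    have : ‖x - y‖ ≤ 5 * (2 / (1 + ‖x‖)) := hy.trans (by unfold localRadius at hr; linarith)
    rw [mul_div_assoc', le_div_iff₀ (by linarith)] at this
    linarith
  have h2 : ‖x - y‖ ≤ 10 := by nlinarith [norm_nonneg (x - y)]
  have h3 : ‖y‖ ≤ ‖x‖ + ‖x - y‖ := by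
    simpa using norm_sub_le x (x - y)
  have h4 : ‖x - y‖ * (‖x‖ + ‖y‖) ≤ 120 := by
    nlinarith [norm_nonneg (x - y)]
  have h5 := potential_sub_le C x y
  nlinarith [norm_nonneg C⁻¹]

/-- The exponent of the kernel on the local region. As `e^{tB} x - y = (x - y) + O(t |x|)` and
`|x - y| |x| ≤ 1` there, replacing `e^{tB} x - y` by `x - y` only costs a constant. -/
theorem exists_kernel_exponent_le {Q : Matrix (Fin d) (Fin d) ℝ} (hQ : Q.PosDef)
    (B : Matrix (Fin d) (Fin d) ℝ) :
    ∃ c K : ℝ, 0 < c ∧ ∀ t : ℝ, 0 < t → ∀ x y : Space d, (x, y) ∈ localRegion d →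
      -(1 / 2) * inner ℝ
          (act (covariance Q B t)⁻¹ (act (NormedSpace.exp (t • B)) x - y))
          (act (NormedSpace.exp (t • B)) x - y)
        ≤ K - c * (‖x - y‖ ^ 2 / min t 1) := by
  obtain ⟨C, hC, hCle⟩ := exists_inner_act_covariance_le Q B
  obtain ⟨M, hM, hMle⟩ := exists_norm_exp_smul_sub_one_le B
  refine ⟨1 / (2 * C), M / C + 1 / (2 * C), by positivity, fun t ht x y hxy => ?_⟩
  have hxy1 := (mem_localRegion_iff.1 hxy).1
  have hxy2 := norm_sub_mul_norm_le hxy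
  rcases le_total t 1 with ht1 | ht1
  · rw [min_eq_left ht1]
    set w := act (NormedSpace.exp (t • B)) x - y with hw
    have h1 := le_inner_act_inv (posDef_covariance hQ B ht) (mul_pos hC ht) (hCle t ht.le ht1) w
    set v := act (NormedSpace.exp (t • B) - 1) x with hv
    have hwv : w = (x - y) + v := by
      rw [hw, hv]
      simp [act]
    have hvle : ‖v‖ ≤ M * t * ‖x‖ :=
      (norm_act_le _ _).trans (by gcongr; exact hMle t ⟨ht.le, ht1⟩)
    have h2 : ‖x - y‖ ^ 2 - 2 * M * t ≤ ‖w‖ ^ 2 := by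
      have h3 : -(‖x - y‖ * ‖v‖) ≤ inner ℝ (x - y) v :=
        neg_le_of_abs_le (abs_real_inner_le_norm _ _)
      have h4 : ‖x - y‖ * ‖v‖ ≤ M * t := by
        calc ‖x - y‖ * ‖v‖ ≤ ‖x - y‖ * (M * t * ‖x‖) := by gcongr
          _ = M * t * (‖x - y‖ * ‖x‖) := by ring
          _ ≤ M * t * 1 := by gcongr
          _ = M * t := mul_one _
      rw [hwv, norm_add_sq_real]
      nlinarith [sq_nonneg ‖v‖]
    have h5 : (C * t)⁻¹ * (‖x - y‖ ^ 2 - 2 * M * t) ≤ (C * t)⁻¹ * ‖w‖ ^ 2 := by gcongr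
    have h6 : (C * t)⁻¹ * (‖x - y‖ ^ 2 - 2 * M * t)
        = 2 * (1 / (2 * C) * (‖x - y‖ ^ 2 / t)) - 2 * (M / C) := by
      field_simp
    have h7 : 0 < 1 / (2 * C) := by positivity
    linarith
  · rw [min_eq_right ht1, div_one]
    have h0 : 0 ≤ inner ℝ
        (act (covariance Q B t)⁻¹ (act (NormedSpace.exp (t • B)) x - y))
        (act (NormedSpace.exp (t • B)) x - y) := by
      obtain ⟨c, hc, h⟩ := exists_le_inner_act_of_posDef (posDef_covariance hQ B ht).inv
      exact le_trans (by positivity) (h _)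
    have h1 : ‖x - y‖ ^ 2 ≤ 1 := pow_le_one₀ (norm_nonneg _) hxy1
    have h2 : 1 / (2 * C) * ‖x - y‖ ^ 2 ≤ 1 / (2 * C) * 1 := by gcongr
    have h3 : 0 < M / C := by positivity
    linarith

theorem kernel_nonneg {Q B : Matrix (Fin d) (Fin d) ℝ} (hQ : Q.PosDef) (hB : IsStable B) {t : ℝ}
    (ht : 0 < t) (x y : Space d) : 0 ≤ kernel Q B t x y := by
  have h1 := (posDef_covarianceInf hQ hB).det_pos
  have h2 := (posDef_covariance hQ B ht).inv.det_pos
  unfold kernel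
  rw [Matrix.det_mul]
  positivity

/-- On the local region the kernel is at most a Euclidean heat kernel times `e^{R(x)}`; for `t ≥ 1`
the heat kernel at time `1` will do. -/
theorem exists_kernel_le {Q B : Matrix (Fin d) (Fin d) ℝ} (hQ : Q.PosDef) (hB : IsStable B) :
    ∃ K c : ℝ, 0 < K ∧ 0 < c ∧ ∀ t : ℝ, 0 < t → ∀ x y : Space d, (x, y) ∈ localRegion d →
      kernel Q B t x y ≤ K * (√(min t 1) ^ d)⁻¹ *
        Real.exp (-c * (‖x - y‖ / √(min t 1)) ^ 2) *
          Real.exp (potential (covarianceInf Q B) x) := by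
  obtain ⟨c, K, hc, hexp⟩ := exists_kernel_exponent_le hQ B
  obtain ⟨b, hb, hdet⟩ := exists_pow_le_det_covariance hQ B
  set C := covarianceInf Q B with hCdef
  have hC : 0 < C.det := (posDef_covarianceInf hQ hB).det_pos
  refine ⟨√C.det * (√b ^ d)⁻¹ * Real.exp (K + ‖C⁻¹‖), c, by positivity, hc, fun t ht x y hxy => ?_⟩
  have hτ : 0 < min t 1 := lt_min ht one_pos
  have h1 : (C * (covariance Q B t)⁻¹).det ^ (1 / 2 : ℝ)
      ≤ √C.det * (√b ^ d)⁻¹ * (√(min t 1) ^ d)⁻¹ := by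
    rw [← Real.sqrt_eq_rpow, Matrix.det_mul, Matrix.det_nonsing_inv, Ring.inverse_eq_inv',
      Real.sqrt_mul hC.le, mul_assoc, ← mul_inv, ← mul_pow, ← Real.sqrt_mul hb.le, Real.sqrt_inv]
    gcongr
    refine Real.le_sqrt_of_sq_le ?_
    rw [← pow_mul, mul_comm d 2, pow_mul, Real.sq_sqrt (by positivity)]
    exact hdet t ht
  have h2 := hexp t ht x y hxy
  have h3 := potential_le_of_mem_localRegion C hxy
  unfold kernel
  calc _ ≤ (√C.det * (√b ^ d)⁻¹ * (√(min t 1) ^ d)⁻¹) *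
        Real.exp (K + ‖C⁻¹‖ + -c * (‖x - y‖ / √(min t 1)) ^ 2 + potential C x) := by
        gcongr
        rw [div_pow, Real.sq_sqrt hτ.le]
        have h4 : potential C y = 1 / 2 * inner ℝ (act C⁻¹ y) y := rfl
        linarith
    _ = _ := by
        rw [Real.exp_add, Real.exp_add]
        ring

theorem localKernel_nonneg {Q B : Matrix (Fin d) (Fin d) ℝ} (hQ : Q.PosDef) (hB : IsStable B)
    {t : ℝ} (ht : 0 < t) (x y : Space d) : 0 ≤ localKernel Q B t x y :=
  indicator_apply_nonneg fun _ => kernel_nonneg hQ hB ht x y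

/-! ### Local maximal functions and Gaussian balls -/

/-- A weak type inequality for maximal functions over balls `B(x, r)` of restricted radius
`r ≤ m x`, by the Vitali covering theorem. The measure `μ` need be doubling on such balls only;
`V x r` is a substitute for `μ (B(x, r))`. -/
theorem mul_measure_exists_lt_measure_closedBall_le {X : Type*} [PseudoMetricSpace X]
    [SecondCountableTopology X] [MeasurableSpace X] [OpensMeasurableSpace X] (μ ν : Measure X)
    {V : X → ℝ → ℝ≥0∞} {m : X → ℝ} {R : ℝ} (hm : ∀ x, m x ≤ R) {K : ℝ≥0∞}
    (hμ : ∀ x r, 0 < r → r ≤ m x → μ (Metric.closedBall x (5 * r)) ≤ K * V x r) (a : ℝ≥0∞) :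
    a * μ {x | ∃ r, 0 < r ∧ r ≤ m x ∧ a * V x r < ν (Metric.closedBall x r)} ≤ K * ν univ := by
  let T : Set (X × ℝ) :=
    {p | 0 < p.2 ∧ p.2 ≤ m p.1 ∧ a * V p.1 p.2 < ν (Metric.closedBall p.1 p.2)}
  obtain ⟨u, huT, hdisj, hcover⟩ :=
    Vitali.exists_disjoint_subfamily_covering_enlargement_closedBall T Prod.fst Prod.snd R
      (fun p hp => hp.2.1.trans (hm _)) 5 (by norm_num)
  have hcount : u.Countable := by
    refine hdisj.countable_of_nonempty_interior fun p hp => ?_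
    exact ⟨p.1, Metric.ball_subset_interior_closedBall (Metric.mem_ball_self (huT hp).1)⟩
  have hsub : {x | ∃ r, 0 < r ∧ r ≤ m x ∧ a * V x r < ν (Metric.closedBall x r)}
      ⊆ ⋃ p ∈ u, Metric.closedBall p.1 (5 * p.2) := by
    rintro x ⟨r, hr0, hr, hlt⟩
    obtain ⟨p, hp, hsub⟩ := hcover (x, r) ⟨hr0, hr, hlt⟩
    exact mem_iUnion₂.2 ⟨p, hp, hsub (Metric.mem_closedBall_self hr0.le)⟩
  calc _ ≤ a * ∑' p : u, μ (Metric.closedBall p.1.1 (5 * p.1.2)) := by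
        gcongr
        exact (measure_mono hsub).trans (measure_biUnion_le μ hcount _)
    _ ≤ a * ∑' p : u, K * V p.1.1 p.1.2 := by
        gcongr with p
        exact hμ _ _ (huT p.2).1 (huT p.2).2.1
    _ = K * ∑' p : u, a * V p.1.1 p.1.2 := by
        rw [ENNReal.tsum_mul_left, ENNReal.tsum_mul_left]
        ring
    _ ≤ K * ∑' p : u, ν (Metric.closedBall p.1.1 p.1.2) := by
        gcongr with p
        exact (huT p.2).2.2.le
    _ = K * ν (⋃ p ∈ u, Metric.closedBall p.1 p.2) := by
        rw [measure_biUnion hcount hdisj fun _ _ => Metric.isClosed_closedBall.measurableSet]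
    _ ≤ K * ν univ := by
        gcongr
        exact subset_univ _

/-- The size `r ^ d e^{-R(x)}`, up to constants, of the Gaussian measure of a ball `B(x, r)` with
`r` at most the local radius of `x`. -/
def localVolume (C : Matrix (Fin d) (Fin d) ℝ) (x : Space d) (r : ℝ) : ℝ≥0∞ :=
  ENNReal.ofReal (r ^ d * Real.exp (-potential C x))

theorem exists_gaussianMeasure_closedBall_le {C : Matrix (Fin d) (Fin d) ℝ} (hC : 0 < C.det) :
    ∃ K : ℝ≥0, ∀ (x : Space d) (r : ℝ), 0 < r → r ≤ localRadius x →
      gaussianMeasure C (Metric.closedBall x (5 * r)) ≤ K * localVolume C x r := by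
  set N : ℝ := (2 * Real.pi) ^ (-(d : ℝ) / 2) * C.det ^ (-(1 / 2) : ℝ) with hN
  have hN0 : 0 ≤ N := by positivity
  have hfin : volume (Metric.ball (0 : Space d) 1) ≠ ∞ := measure_ball_lt_top.ne
  refine ⟨(N * Real.exp (60 * ‖C⁻¹‖) * 5 ^ d).toNNReal *
    (volume (Metric.ball (0 : Space d) 1)).toNNReal, fun x r hr0 hr => ?_⟩
  rw [gaussianMeasure, withDensity_apply _ Metric.isClosed_closedBall.measurableSet]
  calc _ ≤ ∫⁻ _y in Metric.closedBall x (5 * r),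
          ENNReal.ofReal (N * Real.exp (60 * ‖C⁻¹‖) * Real.exp (-potential C x)) := by
        refine setLIntegral_mono measurable_const fun y hy => ENNReal.ofReal_le_ofReal ?_
        rw [gaussianDensity, mul_assoc N, ← Real.exp_add]
        gcongr
        have h1 := potential_le_of_mem_closedBall C hr hy
        have h2 : potential C y = 1 / 2 * inner ℝ (act C⁻¹ y) y := rfl
        linarith
    _ = _ := by
        rw [setLIntegral_const, Measure.addHaar_closedBall _ _ (by positivity), localVolume,
          ENNReal.coe_mul, ENNReal.coe_toNNReal hfin, ← mul_assoc, finrank_euclideanSpace_fin,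
          ← ENNReal.ofReal_mul (by positivity), mul_right_comm (ENNReal.ofNNReal _)]
        change _ = ENNReal.ofReal _ * _ * _
        rw [← ENNReal.ofReal_mul (by positivity)]
        congr 2
        ring

/-! ### Domination by the local maximal function -/

/-- A Gaussian is dominated by a superposition of indicators of balls of radii `(n + 1) σ`. -/
theorem ofReal_exp_le_tsum_indicator {X : Type*} [PseudoMetricSpace X] {c σ : ℝ} (hc : 0 < c)
    (hσ : 0 < σ) (x y : X) :
    ENNReal.ofReal (Real.exp (-c * (dist x y / σ) ^ 2)) ≤
      ∑' n : ℕ, (Metric.closedBall x ((n + 1) * σ)).indicator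
        (fun _ => ENNReal.ofReal (Real.exp (-c * n))) y := by
  set n := ⌊dist x y / σ⌋₊ with hn
  have h0 : 0 ≤ dist x y / σ := by positivity
  have h1 : (n : ℝ) ≤ dist x y / σ := Nat.floor_le h0
  have h2 : dist x y / σ < n + 1 := Nat.lt_floor_add_one _
  refine le_trans ?_ (ENNReal.le_tsum n)
  rw [indicator_of_mem]
  · refine ENNReal.ofReal_le_ofReal (Real.exp_le_exp.2 ?_)
    have h3 : (n : ℝ) ≤ (n : ℝ) ^ 2 := by exact_mod_cast Nat.le_self_pow two_ne_zero n
    have h4 : (n : ℝ) ^ 2 ≤ (dist x y / σ) ^ 2 := by gcongr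
    nlinarith
  · rw [div_lt_iff₀ hσ] at h2
    exact Metric.mem_closedBall'.2 h2.le

theorem summable_succ_pow_mul_exp (d : ℕ) {c : ℝ} (hc : 0 < c) :
    Summable fun n : ℕ => ((n : ℝ) + 1) ^ d * Real.exp (-c * n) := by
  have h := ((summable_nat_add_iff 1).2 (Real.summable_pow_mul_exp_neg_nat_mul d hc)).mul_left
    (Real.exp c)
  refine h.congr fun n => ?_
  push_cast
  rw [mul_left_comm, ← Real.exp_add]
  ring_nf

/-- At every point and every time, the local operator is controlled by the maximal function over
balls of at most the local radius. -/
theorem exists_lintegral_localKernel_le {Q B : Matrix (Fin d) (Fin d) ℝ} (hQ : Q.PosDef)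
    (hB : IsStable B) :
    ∃ K : ℝ≥0, 0 < K ∧ ∀ (g : Space d → ℝ≥0∞), AEMeasurable g (invariantMeasure Q B) →
      ∀ (x : Space d) (a : ℝ≥0∞),
        (∀ r, 0 < r → r ≤ localRadius x →
          ∫⁻ y in Metric.closedBall x r, g y ∂(invariantMeasure Q B)
            ≤ a * localVolume (covarianceInf Q B) x r) →
        ∀ t : ℝ, 0 < t →
          ∫⁻ y, ‖localKernel Q B t x y‖ₑ * g y ∂(invariantMeasure Q B) ≤ K * a := by
  obtain ⟨K, c, hK, hc, hker⟩ := exists_kernel_le hQ hB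
  have hsum := summable_succ_pow_mul_exp d hc
  set S : ℝ := ∑' n : ℕ, ((n : ℝ) + 1) ^ d * Real.exp (-c * n) with hS
  have hS0 : 0 < S := hsum.tsum_pos (fun n => by positivity) 0 (by simp)
  refine ⟨(K * S).toNNReal, by simpa using mul_pos hK hS0, fun g hg x a hball t ht => ?_⟩
  set C := covarianceInf Q B
  set γ := invariantMeasure Q B
  set σ : ℝ := √(min t 1) with hσdef
  have hσ : 0 < σ := Real.sqrt_pos.2 (lt_min ht one_pos)
  set A : ℝ := K * (σ ^ d)⁻¹ * Real.exp (potential C x) with hA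
  have hA0 : 0 ≤ A := by positivity
  let r : ℕ → ℝ := fun n => min ((n + 1) * σ) (localRadius x)
  have hr0 : ∀ n, 0 < r n := fun n => lt_min (by positivity) (localRadius_pos x)
  have hpt : ∀ y, ‖localKernel Q B t x y‖ₑ * g y ≤ ENNReal.ofReal A *
      ∑' n : ℕ, ENNReal.ofReal (Real.exp (-c * n)) * (Metric.closedBall x (r n)).indicator g y := by
    intro y
    by_cases hy : (x, y) ∈ localRegion d
    · have hyr := mem_closedBall_of_mem_localRegion hy
      have h1 : ‖localKernel Q B t x y‖ₑ
          ≤ ENNReal.ofReal A * ENNReal.ofReal (Real.exp (-c * (dist x y / σ) ^ 2)) := by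
        rw [Real.enorm_of_nonneg (localKernel_nonneg hQ hB ht x y), localKernel,
          indicator_of_mem hy, ← ENNReal.ofReal_mul hA0, dist_eq_norm]
        refine ENNReal.ofReal_le_ofReal ((hker t ht x y hy).trans_eq ?_)
        rw [hA]
        ring
      calc _ ≤ ENNReal.ofReal A * (∑' n : ℕ, (Metric.closedBall x ((n + 1) * σ)).indicator
            (fun _ => ENNReal.ofReal (Real.exp (-c * n))) y) * g y := by
            gcongr
            exact h1.trans (by gcongr; exact ofReal_exp_le_tsum_indicator hc hσ x y)
        _ = _ := by
            rw [mul_assoc, ← ENNReal.tsum_mul_right]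
            congr 2 with n
            have e : y ∈ Metric.closedBall x (r n) ↔ y ∈ Metric.closedBall x ((n + 1) * σ) := by
              rw [Metric.mem_closedBall] at hyr ⊢
              rw [Metric.mem_closedBall, le_min_iff, and_iff_left hyr]
            by_cases h : y ∈ Metric.closedBall x ((n + 1) * σ)
            · rw [indicator_of_mem h, indicator_of_mem (e.2 h)]
            · rw [indicator_of_notMem h, indicator_of_notMem (mt e.1 h)]
              simp
    · simp [localKernel, hy]
  calc _ ≤ ∫⁻ y, ENNReal.ofReal A * ∑' n : ℕ, ENNReal.ofReal (Real.exp (-c * n)) *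
        (Metric.closedBall x (r n)).indicator g y ∂γ := lintegral_mono hpt
    _ = ENNReal.ofReal A * ∑' n : ℕ, ENNReal.ofReal (Real.exp (-c * n)) *
        ∫⁻ y in Metric.closedBall x (r n), g y ∂γ := by
        have hm : ∀ n, MeasurableSet (Metric.closedBall x (r n)) := fun n =>
          Metric.isClosed_closedBall.measurableSet
        rw [lintegral_const_mul' _ _ ENNReal.ofReal_ne_top,
          lintegral_tsum fun n => (hg.indicator (hm n)).const_mul _]
        congr 2 with n
        rw [lintegral_const_mul' _ _ ENNReal.ofReal_ne_top, lintegral_indicator (hm n)]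
    _ ≤ ENNReal.ofReal A * ∑' n : ℕ, ENNReal.ofReal (Real.exp (-c * n)) *
        (a * ENNReal.ofReal (((n + 1) * σ) ^ d * Real.exp (-potential C x))) := by
        gcongr with n
        refine (hball _ (hr0 n) (min_le_right _ _)).trans ?_
        unfold localVolume
        gcongr
        · exact (hr0 n).le
        · exact min_le_left _ _
    _ = ∑' n : ℕ, a * ENNReal.ofReal (K * (((n : ℝ) + 1) ^ d * Real.exp (-c * n))) := by
        rw [← ENNReal.tsum_mul_left]
        congr 1 with n
        rw [mul_left_comm _ a, mul_left_comm _ a, ← ENNReal.ofReal_mul (by positivity),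
          ← ENNReal.ofReal_mul hA0]
        congr 2
        rw [hA, Real.exp_neg, mul_pow]
        have := (Real.exp_pos (potential C x)).ne'
        field_simp
    _ = a * ENNReal.ofReal (K * S) := by
        rw [ENNReal.tsum_mul_left, ← ENNReal.ofReal_tsum_of_nonneg (fun n => by positivity)
          (hsum.mul_left K), tsum_mul_left]
    _ = _ := mul_comm _ _

/-! ### Measurability and the weak type inequality -/

theorem continuous_act_uncurry :
    Continuous fun p : Matrix (Fin d) (Fin d) ℝ × Space d => act p.1 p.2 := by
  have : Continuous fun p : Matrix (Fin d) (Fin d) ℝ × Space d => p.1 *ᵥ p.2.ofLp :=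
    continuous_fst.matrix_mulVec ((PiLp.continuous_ofLp 2 _).comp continuous_snd)
  exact (PiLp.continuous_toLp 2 _).comp this

/-- The kernel as a function of `Q_t⁻¹`, `e^{tB}`, `x` and `y`. -/
theorem continuous_kernel_formula (C : Matrix (Fin d) (Fin d) ℝ) :
    Continuous fun p : (Matrix (Fin d) (Fin d) ℝ × Matrix (Fin d) (Fin d) ℝ) ×
        (Space d × Space d) =>
      (C * p.1.1).det ^ (1 / 2 : ℝ) * Real.exp (-(1 / 2) *
        (inner ℝ (act p.1.1 (act p.1.2 p.2.1 - p.2.2)) (act p.1.2 p.2.1 - p.2.2)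
          - inner ℝ (act C⁻¹ p.2.2) p.2.2)) := by
  have hdet : Continuous fun p : (Matrix (Fin d) (Fin d) ℝ × Matrix (Fin d) (Fin d) ℝ) ×
      (Space d × Space d) => (C * p.1.1).det ^ (1 / 2 : ℝ) :=
    ((continuous_const.matrix_mul (continuous_fst.comp continuous_fst)).matrix_det).rpow_const
      fun _ => Or.inr (by norm_num)
  have hw : Continuous fun p : (Matrix (Fin d) (Fin d) ℝ × Matrix (Fin d) (Fin d) ℝ) ×
      (Space d × Space d) => act p.1.2 p.2.1 - p.2.2 :=
    (continuous_act_uncurry.comp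
      ((continuous_snd.comp continuous_fst).prodMk (continuous_fst.comp continuous_snd))).sub
      (continuous_snd.comp continuous_snd)
  have hMw : Continuous fun p : (Matrix (Fin d) (Fin d) ℝ × Matrix (Fin d) (Fin d) ℝ) ×
      (Space d × Space d) => act p.1.1 (act p.1.2 p.2.1 - p.2.2) :=
    continuous_act_uncurry.comp ((continuous_fst.comp continuous_fst).prodMk hw)
  have hy : Continuous fun p : (Matrix (Fin d) (Fin d) ℝ × Matrix (Fin d) (Fin d) ℝ) ×
      (Space d × Space d) => p.2.2 := continuous_snd.comp continuous_snd
  exact hdet.mul (Real.continuous_exp.comp (continuous_const.mul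
    ((hMw.inner hw).sub (((continuous_act C⁻¹).comp hy).inner hy))))

theorem continuous_kernel (Q B : Matrix (Fin d) (Fin d) ℝ) (t : ℝ) :
    Continuous fun p : Space d × Space d => kernel Q B t p.1 p.2 :=
  (continuous_kernel_formula (covarianceInf Q B)).comp
    (f := fun p => (((covariance Q B t)⁻¹, NormedSpace.exp (t • B)), p))
    (continuous_const.prodMk continuous_id)

theorem continuousAt_kernel {Q : Matrix (Fin d) (Fin d) ℝ} (hQ : Q.PosDef)
    (B : Matrix (Fin d) (Fin d) ℝ) {t : ℝ} (ht : 0 < t) (x y : Space d) :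
    ContinuousAt (fun s => kernel Q B s x y) t := by
  have h1 : ContinuousAt (fun s => (covariance Q B s)⁻¹) t :=
    (continuousOn_covariance_inv hQ B).continuousAt (Ioi_mem_nhds ht)
  have h2 : ContinuousAt (fun s : ℝ => NormedSpace.exp (s • B)) t :=
    (continuous_exp_smul B).continuousAt
  exact (continuous_kernel_formula (covarianceInf Q B)).continuousAt.comp
    (f := fun s => (((covariance Q B s)⁻¹, NormedSpace.exp (s • B)), (x, y)))
    ((h1.prodMk h2).prodMk continuousAt_const)

theorem measurableSet_localRegion (d : ℕ) : MeasurableSet (localRegion d) := by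
  have : localRegion d = {p | ‖p.1 - p.2‖ ≤ 1} ∩ {p | ‖p.1 - p.2‖ * ‖p.1 + p.2‖ ≤ 1} := by
    ext ⟨x, y⟩
    exact mem_localRegion_iff
  rw [this]
  exact (isClosed_le (by fun_prop) (by fun_prop)).measurableSet.inter
    (isClosed_le (by fun_prop) (by fun_prop)).measurableSet

theorem measurable_localKernel (Q B : Matrix (Fin d) (Fin d) ℝ) (t : ℝ) :
    Measurable fun p : Space d × Space d => localKernel Q B t p.1 p.2 :=
  (continuous_kernel Q B t).measurable.indicator (measurableSet_localRegion d)

theorem continuousAt_localKernel {Q : Matrix (Fin d) (Fin d) ℝ} (hQ : Q.PosDef)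
    (B : Matrix (Fin d) (Fin d) ℝ) {t : ℝ} (ht : 0 < t) (x y : Space d) :
    ContinuousAt (fun s => localKernel Q B s x y) t := by
  by_cases h : (x, y) ∈ localRegion d
  · simpa [localKernel, h] using continuousAt_kernel hQ B ht x y
  · simpa [localKernel, h] using continuousAt_const

/-- The local kernel is bounded in `y`, uniformly for times bounded away from `0`. -/
theorem exists_norm_localKernel_le {Q B : Matrix (Fin d) (Fin d) ℝ} (hQ : Q.PosDef)
    (hB : IsStable B) (x : Space d) {t₀ : ℝ} (ht₀ : 0 < t₀) :
    ∃ M : ℝ, ∀ t, t₀ ≤ t → ∀ y, ‖localKernel Q B t x y‖ ≤ M := by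
  obtain ⟨K, c, hK, hc, hker⟩ := exists_kernel_le hQ hB
  refine ⟨K * (√(min t₀ 1) ^ d)⁻¹ * 1 * Real.exp (potential (covarianceInf Q B) x),
    fun t ht y => ?_⟩
  have h0 : 0 < min t₀ 1 := lt_min ht₀ one_pos
  by_cases hy : (x, y) ∈ localRegion d
  · rw [Real.norm_of_nonneg (localKernel_nonneg hQ hB (ht₀.trans_le ht) x y), localKernel,
      indicator_of_mem hy]
    refine (hker t (ht₀.trans_le ht) x y hy).trans ?_
    gcongr
    exact Real.exp_le_one_iff.2 (by nlinarith [sq_nonneg (‖x - y‖ / √(min t 1))])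
  · rw [localKernel, indicator_of_notMem hy, norm_zero]
    positivity

section Operator

variable {𝕜 : Type*} [RCLike 𝕜] {Q B : Matrix (Fin d) (Fin d) ℝ} {f : Space d → 𝕜}

theorem aestronglyMeasurable_localKernel_smul
    (hf : AEStronglyMeasurable f (invariantMeasure Q B)) (t : ℝ) (x : Space d) :
    AEStronglyMeasurable (fun y => localKernel Q B t x y • f y) (invariantMeasure Q B) :=
  ((measurable_localKernel Q B t).comp measurable_prodMk_left).aestronglyMeasurable.smul hf

theorem integrable_localKernel_smul (hQ : Q.PosDef) (hB : IsStable B)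
    (hf : Integrable f (invariantMeasure Q B)) {t : ℝ} (ht : 0 < t) (x : Space d) :
    Integrable (fun y => localKernel Q B t x y • f y) (invariantMeasure Q B) := by
  obtain ⟨M, hM⟩ := exists_norm_localKernel_le hQ hB x ht
  refine (hf.norm.const_mul M).mono' (aestronglyMeasurable_localKernel_smul hf.1 t x)
    (Eventually.of_forall fun y => ?_)
  rw [norm_smul]
  gcongr
  exact hM t le_rfl y

theorem continuousAt_integral_localKernel (hQ : Q.PosDef) (hB : IsStable B)
    (hf : Integrable f (invariantMeasure Q B)) {t : ℝ} (ht : 0 < t) (x : Space d) :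
    ContinuousAt (fun s => ∫ y, localKernel Q B s x y • f y ∂(invariantMeasure Q B)) t := by
  obtain ⟨M, hM⟩ := exists_norm_localKernel_le hQ hB x (half_pos ht)
  refine continuousAt_of_dominated (bound := fun y => M * ‖f y‖)
    (Eventually.of_forall fun s => aestronglyMeasurable_localKernel_smul hf.1 s x) ?_
    (hf.norm.const_mul M)
    (Eventually.of_forall fun y => (continuousAt_localKernel hQ B ht x y).smul continuousAt_const)
  filter_upwards [Ioi_mem_nhds (half_lt_self ht)] with s hs
  refine Eventually.of_forall fun y => ?_
  rw [norm_smul]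
  gcongr
  exact hM s (le_of_lt hs) y

/-- By continuity in time, rational times suffice in the definition of the maximal operator. -/
theorem localMaximal_eq_iSup_rat (hQ : Q.PosDef) (hB : IsStable B)
    (hf : Integrable f (invariantMeasure Q B)) (x : Space d) :
    localMaximal Q B f x = ⨆ (q : ℚ) (_ : 0 < q),
      ‖∫ y, localKernel Q B q x y • f y ∂(invariantMeasure Q B)‖ₑ := by
  refine le_antisymm (iSup₂_le fun t ht => ?_) (iSup₂_le fun q hq =>
    le_iSup₂ (f := fun (t : ℝ) (_ : 0 < t) =>
      ‖∫ y, localKernel Q B t x y • f y ∂(invariantMeasure Q B)‖ₑ) (q : ℝ) (by exact_mod_cast hq))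
  by_contra! hlt
  have hev := (continuousAt_integral_localKernel hQ hB hf ht x).enorm.eventually_const_lt hlt
  obtain ⟨U, hU, hUo, htU⟩ := eventually_nhds_iff.1 (hev.and (Ioi_mem_nhds ht))
  obtain ⟨q, hq⟩ := Rat.denseRange_cast.exists_mem_open hUo ⟨t, htU⟩
  obtain ⟨h1, h2⟩ := hU _ hq
  have hq0 : 0 < q := by exact_mod_cast h2
  exact h1.not_ge (le_iSup₂ (f := fun (q : ℚ) (_ : 0 < q) =>
    ‖∫ y, localKernel Q B q x y • f y ∂(invariantMeasure Q B)‖ₑ) q hq0)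

theorem measurable_localMaximal (hQ : Q.PosDef) (hB : IsStable B)
    (hf : Integrable f (invariantMeasure Q B)) : Measurable (localMaximal Q B f) := by
  -- The integrals only see the class of `f`, so `f` may be replaced by a measurable representative.
  have hsf : SFinite (invariantMeasure Q B) := by
    unfold invariantMeasure gaussianMeasure
    infer_instance
  have e : localMaximal Q B f = fun x => ⨆ (q : ℚ) (_ : 0 < q),
      ‖∫ y, localKernel Q B q x y • hf.1.mk f y ∂(invariantMeasure Q B)‖ₑ := by
    funext x
    rw [localMaximal_eq_iSup_rat hQ hB hf x]
    refine iSup_congr fun q => iSup_congr fun _ => congrArg _ (integral_congr_ae ?_)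
    filter_upwards [hf.1.ae_eq_mk] with y hy
    rw [hy]
  rw [e]
  refine Measurable.iSup fun q => Measurable.iSup fun _ => ?_
  refine StronglyMeasurable.enorm (StronglyMeasurable.integral_prod_right'
    (f := fun p : Space d × Space d => localKernel Q B q p.1 p.2 • hf.1.mk f p.2) ?_)
  exact (measurable_localKernel Q B q).stronglyMeasurable.smul
    (hf.1.stronglyMeasurable_mk.comp_measurable measurable_snd)

end Operator

theorem isWeakTypeOne_localMaximal {Q B : Matrix (Fin d) (Fin d) ℝ} (hQ : Q.PosDef)
    (hB : IsStable B) (𝕜 : Type*) [RCLike 𝕜] :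
    IsWeakTypeOne (invariantMeasure Q B) (localMaximal (𝕜 := 𝕜) Q B) := by
  obtain ⟨K, hK, hker⟩ := exists_lintegral_localKernel_le hQ hB
  obtain ⟨D, hD⟩ := exists_gaussianMeasure_closedBall_le (posDef_covarianceInf hQ hB).det_pos
  refine ⟨D * K, fun f hf => ⟨(measurable_localMaximal hQ hB hf).aemeasurable, fun α hα => ?_⟩⟩
  set γ := invariantMeasure Q B with hγ
  set ν := γ.withDensity fun y => ‖f y‖ₑ with hν
  have hK0 : (K : ℝ≥0∞) ≠ 0 := by exact_mod_cast hK.ne'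
  have hα0 : (α : ℝ≥0∞) ≠ 0 := by exact_mod_cast hα.ne'
  have hsub : {x | (α : ℝ≥0∞) < localMaximal Q B f x} ⊆
      {x | ∃ r, 0 < r ∧ r ≤ localRadius x ∧
        α / K * localVolume (covarianceInf Q B) x r < ν (Metric.closedBall x r)} := by
    intro x (hx : (α : ℝ≥0∞) < localMaximal Q B f x)
    by_contra hcon
    refine absurd hx (not_lt.2 (iSup₂_le fun t ht => ?_))
    refine (enorm_integral_le_lintegral_enorm _).trans ?_
    simp only [enorm_smul]
    refine (hker (fun y => ‖f y‖ₑ) hf.1.enorm x (α / K) (fun r hr0 hr => ?_) t ht).trans_eq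
      (ENNReal.mul_div_cancel hK0 ENNReal.coe_ne_top)
    by_contra! hlt
    refine hcon ⟨r, hr0, hr, ?_⟩
    rwa [hν, withDensity_apply _ Metric.isClosed_closedBall.measurableSet]
  have hvitali := mul_measure_exists_lt_measure_closedBall_le γ ν (m := localRadius)
    localRadius_le_two hD (α / K)
  have huniv : ν univ = ∫⁻ x, ‖f x‖ₑ ∂γ := by
    rw [hν, withDensity_apply _ MeasurableSet.univ, Measure.restrict_univ]
  rw [huniv] at hvitali
  rw [ENNReal.le_div_iff_mul_le (Or.inl hα0) (Or.inl ENNReal.coe_ne_top)]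
  calc _ ≤ γ {x | ∃ r, 0 < r ∧ r ≤ localRadius x ∧
        α / K * localVolume (covarianceInf Q B) x r < ν (Metric.closedBall x r)} * α := by
        gcongr
    _ = K * (α / K * γ {x | ∃ r, 0 < r ∧ r ≤ localRadius x ∧
        α / K * localVolume (covarianceInf Q B) x r < ν (Metric.closedBall x r)}) := by
        rw [← mul_assoc, ENNReal.mul_div_cancel hK0 ENNReal.coe_ne_top, mul_comm]
    _ ≤ K * (D * ∫⁻ x, ‖f x‖ₑ ∂γ) := by gcongr
    _ = _ := by
        rw [ENNReal.coe_mul]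
        ring

end OrnsteinUhlenbeck

end

theorem proposition5p4 {d : ℕ} (Q B : Matrix (Fin d) (Fin d) ℝ)
    (hQ : Q.PosDef) (hB0 : B ≠ 0) (hB : OrnsteinUhlenbeck.IsStable B)
    (𝕜 : Type*) [RCLike 𝕜] :
    (∀ f : OrnsteinUhlenbeck.Space d → 𝕜,
      Integrable f (OrnsteinUhlenbeck.invariantMeasure Q B) →
      ∀ t : ℝ, 0 < t → ∀ x : OrnsteinUhlenbeck.Space d,
        Integrable (fun y => OrnsteinUhlenbeck.localKernel Q B t x y • f y)
          (OrnsteinUhlenbeck.invariantMeasure Q B)) ∧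
    OrnsteinUhlenbeck.IsWeakTypeOne (OrnsteinUhlenbeck.invariantMeasure Q B)
      (OrnsteinUhlenbeck.localMaximal (𝕜 := 𝕜) Q B) :=
  ⟨fun _ hf _ ht x => OrnsteinUhlenbeck.integrable_localKernel_smul hQ hB hf ht x,
    OrnsteinUhlenbeck.isWeakTypeOne_localMaximal hQ hB 𝕜⟩
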